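/- Let $G$ be a finite group of order $n$ that is not cyclic of prime power order, where $1$ is counted as a prime power (so the trivial group is excluded as well). Let $\Gamma_G$ be the power graph of $G$: the simple graph with vertex set $G$ in which two distinct elements are adjacent if and only if one of them is a power of the other. An $L(2,1)$-labeling of a finite graph $\Gamma$ is a function $f$ from the vertices of $\Gamma$ to the nonnegative integers such that $|f(u)-f(v)|\ge 2$ whenever $u$ and $v$ are adjacent and $|f(u)-f(v)|\ge 1$ whenever $u$ and $v$ are at distance two; its span is the difference between its maximum and minimum values, and $\lambda(\Gamma)$ denotes the minimum span over all $L(2,1)$-labelings of $\Gamma$. Then $$\lambda(\Gamma_G)\le 2n-4,$$ with equality if and only if $G$ is isomorphic to $\mathbb{Z}_2\times\mathbb{Z}_2$ or to $\mathbb{Z}_{2q}$ for some odd prime $q$. -/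

import Mathlib

namespace LambdaNumber

/-- An `L(j,k)`-labeling of a simple graph: labels of adjacent vertices differ by at least `j`, and
labels of vertices at distance two differ by at least `k`. (A distance `Γ.dist u v` equal to `2`
is the length of an actual shortest path: the default value for unreachable vertices is `0`.) -/
def IsLabeling {V : Type*} (Γ : SimpleGraph V) (j k : ℕ) (f : V → ℕ) : Prop :=
  (∀ u v : V, Γ.Adj u v → (j : ℤ) ≤ |(f u : ℤ) - (f v : ℤ)|) ∧
  (∀ u v : V, Γ.dist u v = 2 → (k : ℤ) ≤ |(f u : ℤ) - (f v : ℤ)|)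

/-- The span of a labeling of a finite vertex set: its maximum value minus its minimum value. -/
noncomputable def span {V : Type*} [Finite V] (f : V → ℕ) : ℕ :=
  (⨆ v, f v) - (⨅ v, f v)

/-- The `L(j,k)`-labeling number of a finite graph: the minimum span of an `L(j,k)`-labeling. -/
noncomputable def labelingNumber {V : Type*} [Finite V] (Γ : SimpleGraph V) (j k : ℕ) : ℕ :=
  sInf {s : ℕ | ∃ f : V → ℕ, IsLabeling Γ j k f ∧ span f = s}

/-- The `λ`-number of a finite graph, that is, its `L(2,1)`-labeling number. -/
noncomputable def lambdaNumber {V : Type*} [Finite V] (Γ : SimpleGraph V) : ℕ :=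
  labelingNumber Γ 2 1

/-- The (undirected) power graph of a group: two distinct elements are adjacent if one of them is
a power of the other. -/
def powerGraph (G : Type*) [Group G] : SimpleGraph G where
  Adj x y := x ≠ y ∧ ((∃ m : ℕ, y = x ^ m) ∨ (∃ m : ℕ, x = y ^ m))
  symm := ⟨fun _ _ h => ⟨h.1.symm, h.2.symm⟩⟩
  loopless := ⟨fun _ h => h.1 rfl⟩

/-- The minimum defining the `L(j,k)`-labeling number is attained. -/
theorem exists_isLabeling_span_eq {V : Type*} [Finite V] (Γ : SimpleGraph V) (j k : ℕ) :
    ∃ f : V → ℕ, IsLabeling Γ j k f ∧ span f = labelingNumber Γ j k := by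
  have key : Set.Nonempty {s : ℕ | ∃ f : V → ℕ, IsLabeling Γ j k f ∧ span f = s} := by
    obtain ⟨n, ⟨e⟩⟩ := Finite.exists_equiv_fin V
    have hd : ∀ u v : V, u ≠ v →
        ((j + k : ℕ) : ℤ) ≤ |(((j + k) * (e u : ℕ) : ℕ) : ℤ) - (((j + k) * (e v : ℕ) : ℕ) : ℤ)| := by
      intro u v h
      have h1 : ((e u : ℕ) : ℤ) - ((e v : ℕ) : ℤ) ≠ 0 := by
        intro h0
        apply h
        apply e.injective
        apply Fin.ext
        omega
      have h2 := Int.one_le_abs h1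
      push_cast
      rw [← mul_sub, abs_mul, abs_of_nonneg (by positivity : (0 : ℤ) ≤ (j : ℤ) + k)]
      exact le_mul_of_one_le_right (by positivity) h2
    refine ⟨_, fun v => (j + k) * (e v : ℕ), ⟨fun u v h => ?_, fun u v h => ?_⟩, rfl⟩
    · exact le_trans (by push_cast; omega) (hd u v h.ne)
    · refine le_trans (by push_cast; omega) (hd u v ?_)
      rintro rfl
      simp at h
  exact Nat.sInf_mem key

end LambdaNumber

/-! In a graph of diameter at most two an `L(2,1)`-labeling is injective, and two vertices carrying
consecutive labels form an edge of the complement. So the labeling number is governed by linear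
forests in the complement: a path with `ℓ` edges there saves `ℓ` on the trivial bound `2n - 2`, and
if the edges of the complement pairwise meet, then no more than two can be saved.

In the complement of the power graph, an edge `x y` extends to a path with two edges: append `y⁻¹`
or `x⁻¹`, or else `x * y` when `x` and `y` are both involutions. Suppose that no path has three
edges. Then every edge contains an involution, since otherwise `x, y, x⁻¹, y⁻¹` is such a path. Two
distinct involutions leave room only for the Klein four-group. If the involution `z` is unique, it
is central, and `z * y` generates the group for any `y` of odd prime order. -/

namespace LambdaNumber

open Subgroup (zpowers mem_zpowers)

/-- Any two edges of the graph have a common vertex, that is, the graph has no two independent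
edges. -/
def EdgesMeet {V : Type*} (Γ : SimpleGraph V) : Prop :=
  ∀ ⦃a b c d : V⦄, Γ.Adj a b → Γ.Adj c d → a = c ∨ a = d ∨ b = c ∨ b = d

/-- No path of the graph has more than `k` edges. -/
def PathLengthLE {V : Type*} (Γ : SimpleGraph V) (k : ℕ) : Prop :=
  ∀ ⦃u v : V⦄ (p : Γ.Walk u v), p.IsPath → p.length ≤ k

section Labeling

variable {V : Type*} {Γ : SimpleGraph V} {f : V → ℕ}

theorem isLabeling_of_injective (hf : f.Injective)
    (hadj : ∀ u v, f v = f u + 1 → ¬ Γ.Adj u v) : IsLabeling Γ 2 1 f := by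
  refine ⟨fun u v h => ?_, fun u v h => ?_⟩
  · have hne := hf.ne h.ne
    have huv := mt (hadj u v) (not_not.2 h)
    have hvu := mt (hadj v u) (not_not.2 h.symm)
    rw [le_abs]
    omega
  · have hne : f u ≠ f v := hf.ne fun huv => by simp [huv] at h
    rw [le_abs]
    omega

theorem IsLabeling.injective {j k : ℕ} (hf : IsLabeling Γ j k f) (hj : 0 < j) (hk : 0 < k)
    (hΓ : Γ.ediam ≤ 2) : f.Injective := by
  intro u v huv
  by_contra hne
  have hedist : Γ.edist u v ≤ 2 := SimpleGraph.edist_le_ediam.trans hΓ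
  have hreach : Γ.Reachable u v :=
    SimpleGraph.reachable_of_edist_ne_top (hedist.trans_lt (by decide)).ne
  have hle : Γ.dist u v ≤ 2 := by
    rw [← hreach.coe_dist_eq_edist] at hedist
    exact_mod_cast hedist
  have hpos : 0 < Γ.dist u v := hreach.pos_dist_of_ne hne
  obtain h1 | h2 : Γ.dist u v = 1 ∨ Γ.dist u v = 2 := by omega
  · have := hf.1 u v (SimpleGraph.dist_eq_one_iff_adj.1 h1)
    simp only [huv, sub_self, abs_zero] at this
    omega
  · have := hf.2 u v h2
    simp only [huv, sub_self, abs_zero] at this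
    omega

theorem IsLabeling.not_adj_of_eq_add_one {k : ℕ} (hf : IsLabeling Γ 2 k f) {u v : V}
    (h : f v = f u + 1) : ¬ Γ.Adj u v := by
  intro hadj
  have := hf.1 u v hadj
  simp [h] at this

theorem ediam_le_two_of_isUniversal {e : V} (he : Γ.IsUniversal e) : Γ.ediam ≤ 2 := by
  have hecc : Γ.eccent e ≤ 1 := (SimpleGraph.eccent_le_iff _ _).2 fun v =>
    SimpleGraph.edist_le_one_iff_adj_or_eq.2 ((eq_or_ne e v).symm.imp_left fun h => he h)
  calc Γ.ediam ≤ 2 * Γ.eccent e := SimpleGraph.ediam_le_two_mul_eccent e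
    _ ≤ 2 * 1 := by gcongr
    _ = 2 := mul_one 2

variable [Finite V]

theorem le_span_add (f : V → ℕ) (u v : V) : f u ≤ span f + f v := by
  have hsup : f u ≤ ⨆ w, f w := le_ciSup (Set.finite_range f).bddAbove u
  have hinf : ⨅ w, f w ≤ f v := ciInf_le (OrderBot.bddBelow _) v
  unfold span
  omega

theorem span_le_of_forall_le [Nonempty V] {M : ℕ} (h : ∀ v, f v ≤ M) : span f ≤ M :=
  (Nat.sub_le _ _).trans (ciSup_le h)

theorem IsLabeling.lambdaNumber_le_span (hf : IsLabeling Γ 2 1 f) : lambdaNumber Γ ≤ span f :=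
  Nat.sInf_le ⟨f, hf, rfl⟩

theorem two_mul_card_le_span_add_ncard (hf : f.Injective) :
    2 * Nat.card V ≤ span f + 2 + {v | f v + 1 ∈ Set.range f}.ncard := by
  rcases isEmpty_or_nonempty V with _ | _
  · simp
  set S := {v | f v + 1 ∈ Set.range f}
  obtain ⟨m, hm⟩ := Finite.exists_min f
  have hg : (fun v => f v + 1).Injective := (add_left_injective 1).comp hf
  have hdisj : Disjoint (Set.range f) ((fun v => f v + 1) '' Sᶜ) :=
    Set.disjoint_right.2 <| Set.forall_mem_image.2 fun _ hv => hv
  have hsub : Set.range f ∪ (fun v => f v + 1) '' Sᶜ ⊆ Set.Icc (f m) (f m + span f + 1) := by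
    rintro _ (⟨v, rfl⟩ | ⟨v, -, rfl⟩) <;>
    · have := le_span_add f v m
      have := hm v
      simp only [Set.mem_Icc]
      omega
  have hcard := Set.ncard_le_ncard hsub (Set.finite_Icc _ _)
  rw [Set.ncard_union_eq hdisj (Set.toFinite _) (Set.toFinite _), Set.ncard_image_of_injective _ hg,
    ← Set.image_univ, Set.ncard_image_of_injective _ hf, Set.ncard_univ, ← Finset.coe_Icc,
    Set.ncard_coe_finset, Nat.card_Icc] at hcard
  have := Set.ncard_add_ncard_compl S
  omega

theorem IsLabeling.ncard_succ_mem_range_le_two {k : ℕ} (hf : IsLabeling Γ 2 k f)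
    (hinj : f.Injective) (hΓ : EdgesMeet Γᶜ) : {v | f v + 1 ∈ Set.range f}.ncard ≤ 2 := by
  set S := {v | f v + 1 ∈ Set.range f}
  have hedge : ∀ {u v}, f v = f u + 1 → Γᶜ.Adj u v := fun {u v} h =>
    (Γ.compl_adj u v).2 ⟨fun huv => by simp [huv] at h, hf.not_adj_of_eq_add_one h⟩
  rcases S.eq_empty_or_nonempty with hS | hS
  · simp [hS]
  obtain ⟨m, ⟨m', hm'⟩, hmin⟩ := S.toFinite.exists_minimalFor f S hS
  have hsub : f '' S ⊆ {f m, f m + 1} := by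
    rintro _ ⟨v, ⟨v', hv'⟩, rfl⟩
    have hle : f m ≤ f v := (le_total (f m) (f v)).elim id (hmin ⟨v', hv'⟩)
    rw [Set.mem_insert_iff, Set.mem_singleton_iff]
    rcases hΓ (hedge hm') (hedge hv') with rfl | rfl | rfl | rfl <;> omega
  calc S.ncard = (f '' S).ncard := (Set.ncard_image_of_injective S hinj).symm
    _ ≤ ({f m, f m + 1} : Set ℕ).ncard := Set.ncard_le_ncard hsub
    _ = 2 := Set.ncard_pair (Nat.succ_ne_self _).symm

theorem two_mul_card_le_lambdaNumber_add_four (hdiam : Γ.ediam ≤ 2) (hΓ : EdgesMeet Γᶜ) :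
    2 * Nat.card V ≤ lambdaNumber Γ + 4 := by
  obtain ⟨f, hf, hspan⟩ := exists_isLabeling_span_eq Γ 2 1
  have hinj := hf.injective two_pos one_pos hdiam
  calc 2 * Nat.card V ≤ span f + 2 + {v | f v + 1 ∈ Set.range f}.ncard :=
        two_mul_card_le_span_add_ncard hinj
    _ ≤ span f + 2 + 2 := by grw [hf.ncard_succ_mem_range_le_two hinj hΓ]
    _ = lambdaNumber Γ + 4 := by rw [hspan, lambdaNumber]

open Classical in
/-- The labeling that uses the labels `0, 1, …, p.length` along the path `p` and continues with
gaps of two on the vertices outside `p`. It is an `L(2,1)`-labeling of the complement of the graph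
containing `p`. -/
noncomputable def pathLabeling {u v : V} (p : Γ.Walk u v) (w : V) : ℕ :=
  if h : w ∈ p.support then p.support.idxOf w
  else p.length + 2 + 2 * Finite.equivFin {w // w ∉ p.support} ⟨w, h⟩

section Path

variable {u v : V} (p : Γ.Walk u v) {w : V}

theorem pathLabeling_le_length (hw : w ∈ p.support) : pathLabeling p w ≤ p.length := by
  classical
  have := List.idxOf_lt_length_iff.2 hw
  rw [p.length_support] at this
  rw [pathLabeling, dif_pos hw]
  convert Nat.lt_succ_iff.1 this

theorem getVert_pathLabeling (hw : w ∈ p.support) : p.getVert (pathLabeling p w) = w := by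
  classical
  rw [pathLabeling, dif_pos hw]
  convert p.getVert_support_idxOf hw

theorem pathLabeling_of_notMem (hw : w ∉ p.support) : pathLabeling p w =
    p.length + 2 + 2 * (Finite.equivFin {w // w ∉ p.support} ⟨w, hw⟩ : ℕ) :=
  dif_neg hw

theorem pathLabeling_injective : (pathLabeling p).Injective := by
  intro a b hab
  by_cases ha : a ∈ p.support <;> by_cases hb : b ∈ p.support
  · rw [← getVert_pathLabeling p ha, hab, getVert_pathLabeling p hb]
  · have := pathLabeling_le_length p ha
    have := pathLabeling_of_notMem p hb
    omega
  · have := pathLabeling_le_length p hb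
    have := pathLabeling_of_notMem p ha
    omega
  · rw [pathLabeling_of_notMem p ha, pathLabeling_of_notMem p hb] at hab
    have heq : Finite.equivFin {w // w ∉ p.support} ⟨a, ha⟩ =
        Finite.equivFin {w // w ∉ p.support} ⟨b, hb⟩ := Fin.ext (by omega)
    exact congrArg Subtype.val ((Equiv.injective _) heq)

theorem adj_of_pathLabeling_eq_add_one {a b : V} (h : pathLabeling p b = pathLabeling p a + 1) :
    Γ.Adj a b := by
  by_cases ha : a ∈ p.support <;> by_cases hb : b ∈ p.support
  · have hlt : pathLabeling p a < p.length := by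
      have := pathLabeling_le_length p hb
      omega
    have := p.adj_getVert_succ hlt
    rwa [← h, getVert_pathLabeling p ha, getVert_pathLabeling p hb] at this
  · have := pathLabeling_le_length p ha
    have := pathLabeling_of_notMem p hb
    omega
  · have := pathLabeling_le_length p hb
    have := pathLabeling_of_notMem p ha
    omega
  · rw [pathLabeling_of_notMem p ha, pathLabeling_of_notMem p hb] at h
    omega

variable {p}

theorem pathLabeling_add_length_add_two_le (hp : p.IsPath) (w : V) :
    pathLabeling p w + p.length + 2 ≤ 2 * Nat.card V := by
  classical
  have hcard : p.length + 1 + Nat.card {w // w ∉ p.support} = Nat.card V := by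
    have := Set.ncard_add_ncard_compl {w | w ∈ p.support}
    rwa [← List.coe_toFinset, Set.ncard_coe_finset, List.toFinset_card_of_nodup hp.support_nodup,
      p.length_support, List.coe_toFinset] at this
  by_cases hw : w ∈ p.support
  · have := pathLabeling_le_length p hw
    omega
  · have := (Finite.equivFin {w // w ∉ p.support} ⟨w, hw⟩).isLt
    rw [pathLabeling_of_notMem p hw]
    omega

end Path

theorem lambdaNumber_add_length_add_two_le {u v : V} {p : Γᶜ.Walk u v} (hp : p.IsPath) :
    lambdaNumber Γ + p.length + 2 ≤ 2 * Nat.card V := by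
  have : Nonempty V := ⟨u⟩
  have hlab : IsLabeling Γ 2 1 (pathLabeling p) :=
    isLabeling_of_injective (pathLabeling_injective p) fun _ _ h =>
      ((Γ.compl_adj _ _).1 (adj_of_pathLabeling_eq_add_one p h)).2
  have hspan : span (pathLabeling p) ≤ 2 * Nat.card V - p.length - 2 :=
    span_le_of_forall_le fun w => by
      have := pathLabeling_add_length_add_two_le hp w
      omega
  have := hlab.lambdaNumber_le_span
  have := pathLabeling_add_length_add_two_le hp u
  omega

theorem edgesMeet_compl_of_card_le_four {e : V} (he : Γ.IsUniversal e) (hV : Nat.card V ≤ 4) :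
    EdgesMeet Γᶜ := by
  classical
  have := Fintype.ofFinite V
  intro a b c d hab hcd
  have hne : ∀ {v w}, Γᶜ.Adj v w → e ≠ v := by
    rintro v w hvw rfl
    exact hvw.2 (he hvw.1)
  by_contra! h
  have hfive : ({e, a, b, c, d} : Finset V).card = 5 := by
    simp [hne hab, hne hab.symm, hne hcd, hne hcd.symm, hab.ne, hcd.ne, h]
  have := Finset.card_le_univ {e, a, b, c, d}
  rw [hfive, ← Nat.card_eq_fintype_card] at this
  omega

end Labeling

theorem PathLengthLE.not_adj_of_adj_of_adj {V : Type*} {Γ : SimpleGraph V}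
    (hΓ : PathLengthLE Γ 2) {a b c d : V} (hab : Γ.Adj a b) (hbc : Γ.Adj b c) (hac : a ≠ c)
    (had : a ≠ d) (hbd : b ≠ d) : ¬ Γ.Adj c d := by
  intro hcd
  have := hΓ (.cons hab (.cons hbc (.cons hcd .nil)))
    (by simp [hab.ne, hbc.ne, hcd.ne, hac, had, hbd])
  simp at this

theorem dvd_or_dvd_of_dvd_prime_mul {p q a b : ℕ} (hp : p.Prime) (hq : q.Prime) (ha : a ∣ p * q)
    (hb : b ∣ p * q) : a ∣ b ∨ b ∣ a ∨ a = p ∨ b = p := by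
  obtain ⟨a₁, a₂, ha₁, ha₂, rfl⟩ := Nat.dvd_mul.1 ha
  obtain ⟨b₁, b₂, hb₁, hb₂, rfl⟩ := Nat.dvd_mul.1 hb
  rw [Nat.dvd_prime hp] at ha₁ hb₁
  rw [Nat.dvd_prime hq] at ha₂ hb₂
  rcases ha₁ with rfl | rfl <;> rcases ha₂ with rfl | rfl <;> rcases hb₁ with rfl | rfl <;>
    rcases hb₂ with rfl | rfl <;> simp

section Group

variable {G : Type*} [Group G]

theorem ne_inv_of_orderOf_ne_two {x : G} (h1 : x ≠ 1) (h2 : orderOf x ≠ 2) : x ≠ x⁻¹ := by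
  intro h
  exact h2 (orderOf_eq_prime (by rw [pow_two, ← mul_inv_cancel x, ← h]) h1)

theorem mem_zpowers_iff_of_orderOf_eq_two {x y : G} (hx : orderOf x = 2) :
    y ∈ zpowers x ↔ y = 1 ∨ y = x := by
  classical
  have hfin : IsOfFinOrder x := orderOf_pos_iff.1 (by omega)
  rw [hfin.mem_zpowers_iff_mem_range_orderOf, hx]
  simp [Finset.range_add_one, eq_comm, or_comm]

theorem commute_of_unique_involution {z : G} (hz : orderOf z = 2)
    (huniq : ∀ w : G, orderOf w = 2 → w = z) (g : G) : Commute z g := by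
  have hconj : g * z * g⁻¹ = z := huniq _ (by rw [← MulAut.conj_apply, MulEquiv.orderOf_eq, hz])
  exact (mul_inv_eq_iff_eq_mul.1 hconj).symm

variable [Finite G]

theorem mem_zpowers_of_orderOf_dvd [IsCyclic G] {x y : G} (h : orderOf x ∣ orderOf y) :
    x ∈ zpowers y := by
  classical
  have := Fintype.ofFinite G
  set roots := Finset.univ.filter fun u : G => u ^ orderOf y = 1
  have hsub : (zpowers y : Set G).toFinset ⊆ roots := fun u hu => by
    rw [Set.mem_toFinset, SetLike.mem_coe] at hu
    simpa [roots, ← orderOf_dvd_iff_pow_eq_one] using orderOf_dvd_of_mem_zpowers hu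
  have hcard : roots.card ≤ (zpowers y : Set G).toFinset.card :=
    calc roots.card ≤ orderOf y := IsCyclic.card_pow_eq_one_le (orderOf_pos y)
      _ = (zpowers y : Set G).toFinset.card := by
        rw [Set.toFinset_card, ← Nat.card_eq_fintype_card, ← Nat.card_zpowers]
        rfl
  have hx : x ∈ roots := by simpa [roots, ← orderOf_dvd_iff_pow_eq_one] using h
  rwa [← Finset.eq_of_subset_of_card_le hsub hcard, Set.mem_toFinset] at hx

theorem eq_of_orderOf_eq_two [IsCyclic G] {x y : G} (hx : orderOf x = 2) (hy : orderOf y = 2) :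
    x = y :=
  have hmem : x ∈ zpowers y := mem_zpowers_of_orderOf_dvd (by rw [hx, hy])
  ((mem_zpowers_iff_of_orderOf_eq_two hy).1 hmem).resolve_left fun h => by simp [h] at hx

theorem eq_of_mem_zpowers_of_orderOf_eq_two {g x y : G} (hxg : x ∈ zpowers g)
    (hyg : y ∈ zpowers g) (hx : orderOf x = 2) (hy : orderOf y = 2) : x = y := by
  have h : (⟨x, hxg⟩ : zpowers g) = ⟨y, hyg⟩ :=
    eq_of_orderOf_eq_two (by rw [Subgroup.orderOf_mk, hx]) (by rw [Subgroup.orderOf_mk, hy])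
  exact congrArg Subtype.val h

theorem isCyclic_of_forall_mem_zpowers_or (h : ∀ x y : G, x ∈ zpowers y ∨ y ∈ zpowers x) :
    IsCyclic G := by
  obtain ⟨g, hg⟩ := Finite.exists_max (orderOf : G → ℕ)
  suffices ∀ y, y ∈ zpowers g from ⟨g, this⟩
  refine fun y => (h g y).elim (fun hgy => ?_) id
  have heq : zpowers g = zpowers y := Subgroup.eq_of_le_of_card_ge
    (by rwa [Subgroup.zpowers_le]) (by simpa only [Nat.card_zpowers] using hg y)
  exact heq ▸ mem_zpowers y

theorem isKleinFour_of_forall_eq {x y : G} (hx : orderOf x = 2) (hy : orderOf y = 2) (hne : x ≠ y)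
    (h : ∀ g : G, g = 1 ∨ g = x ∨ g = y ∨ g = x * y) : IsKleinFour G := by
  classical
  have hx1 : x ≠ 1 := by rintro rfl; simp at hx
  have hy1 : y ≠ 1 := by rintro rfl; simp at hy
  have hxy1 : x * y ≠ 1 := fun h => hne <| by
    rw [mul_eq_one_iff_eq_inv.1 h, inv_eq_self_of_orderOf_eq_two hy]
  have huniv : (Set.univ : Set G) = ({1, x, y, x * y} : Finset G) := by
    ext g
    simpa using h g
  have hcard : Nat.card G = 2 ^ 2 := by
    rw [← Set.ncard_univ, huniv, Set.ncard_coe_finset]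
    simp [hne, hx1, hy1, hx1.symm, hy1.symm, hxy1.symm]
  exact ⟨hcard, (not_isCyclic_iff_exponent_eq_prime Nat.prime_two hcard).1
    fun _ => hne (eq_of_orderOf_eq_two hx hy)⟩

end Group

section PowerGraph

variable {G : Type*} [Group G]

theorem isUniversal_one : (powerGraph G).IsUniversal 1 := fun x hx =>
  ⟨hx, Or.inr ⟨0, (pow_zero x).symm⟩⟩

variable {x y z : G}

theorem ne_one_of_compl_powerGraph_adj (h : (powerGraph G)ᶜ.Adj x y) : x ≠ 1 := by
  rintro rfl
  exact h.2 (isUniversal_one h.1)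

variable [Finite G]

theorem compl_powerGraph_adj : (powerGraph G)ᶜ.Adj x y ↔ x ∉ zpowers y ∧ y ∉ zpowers x := by
  have hpow : ∀ x y : G, (∃ m : ℕ, x = y ^ m) ↔ x ∈ zpowers y := fun x y => by
    simp only [← mem_powers_iff_mem_zpowers, Submonoid.mem_powers_iff, eq_comm]
  have hne : x ∉ zpowers y → x ≠ y := by
    rintro h rfl
    exact h (mem_zpowers x)
  simp only [SimpleGraph.compl_adj, powerGraph, hpow]
  tauto

theorem compl_powerGraph_adj_inv_right :
    (powerGraph G)ᶜ.Adj x y⁻¹ ↔ (powerGraph G)ᶜ.Adj x y := by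
  rw [compl_powerGraph_adj, compl_powerGraph_adj, Subgroup.zpowers_inv, inv_mem_iff]

theorem compl_powerGraph_adj_of_coprime (hx : x ≠ 1) (hy : y ≠ 1)
    (h : (orderOf x).Coprime (orderOf y)) : (powerGraph G)ᶜ.Adj x y := by
  rw [compl_powerGraph_adj]
  exact ⟨fun hxy => hx (orderOf_eq_one_iff.1 (h.eq_one_of_dvd (orderOf_dvd_of_mem_zpowers hxy))),
    fun hyx => hy (orderOf_eq_one_iff.1 (h.symm.eq_one_of_dvd (orderOf_dvd_of_mem_zpowers hyx)))⟩

theorem compl_powerGraph_adj_iff_of_orderOf_eq_two (hx : orderOf x = 2) :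
    (powerGraph G)ᶜ.Adj x y ↔ x ∉ zpowers y ∧ y ≠ 1 := by
  rw [compl_powerGraph_adj, mem_zpowers_iff_of_orderOf_eq_two hx, not_or, and_congr_right_iff,
    and_iff_left_iff_imp]
  rintro hxy - rfl
  exact hxy (mem_zpowers y)

theorem exists_compl_powerGraph_adj
    (hG : ¬ (IsCyclic G ∧ ∃ p k : ℕ, p.Prime ∧ Nat.card G = p ^ k)) :
    ∃ x y : G, (powerGraph G)ᶜ.Adj x y := by
  by_contra! hadj
  refine hG ⟨isCyclic_of_forall_mem_zpowers_or fun x y => ?_, ?_⟩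
  · have := hadj x y
    rw [compl_powerGraph_adj] at this
    tauto
  by_cases h1 : Nat.card G = 1
  · exact ⟨2, 0, Nat.prime_two, by simpa using h1⟩
  obtain ⟨p, hp, hpG⟩ := Nat.exists_prime_and_dvd h1
  refine ⟨p, _, hp, Nat.eq_prime_pow_of_unique_prime_dvd Nat.card_pos.ne' fun {q} hq hqG => ?_⟩
  have := Fact.mk hp
  have := Fact.mk hq
  obtain ⟨x, hx⟩ := exists_prime_orderOf_dvd_card' p hpG
  obtain ⟨y, hy⟩ := exists_prime_orderOf_dvd_card' q hqG
  by_contra hne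
  refine hadj x y (compl_powerGraph_adj_of_coprime ?_ ?_ ?_)
  · rintro rfl
    exact hp.ne_one (by simpa using hx.symm)
  · rintro rfl
    exact hq.ne_one (by simpa using hy.symm)
  · rw [hx, hy]
    exact (Nat.coprime_primes hp hq).2 (Ne.symm hne)

theorem compl_powerGraph_adj_mul_right (hx : orderOf x = 2) (hy : orderOf y = 2) (hne : x ≠ y) :
    (powerGraph G)ᶜ.Adj x (x * y) := by
  rw [compl_powerGraph_adj_iff_of_orderOf_eq_two hx]
  refine ⟨fun hmem => ?_, fun h => ?_⟩
  · have hy_mem : y ∈ zpowers (x * y) := (Subgroup.mul_mem_cancel_left _ hmem).1 (mem_zpowers _)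
    exact hne (eq_of_mem_zpowers_of_orderOf_eq_two hmem hy_mem hx hy)
  · rw [mul_eq_one_iff_eq_inv, inv_eq_self_of_orderOf_eq_two hy] at h
    exact hne h

theorem compl_powerGraph_adj_mul_left (hx : orderOf x = 2) (hy : orderOf y = 2) (hne : x ≠ y) :
    (powerGraph G)ᶜ.Adj y (x * y) := by
  have := compl_powerGraph_adj_mul_right hy hx hne.symm
  rwa [← compl_powerGraph_adj_inv_right, mul_inv_rev, inv_eq_self_of_orderOf_eq_two hx,
    inv_eq_self_of_orderOf_eq_two hy] at this

theorem exists_isPath_length_eq_two (h : (powerGraph G)ᶜ.Adj x y) :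
    ∃ (u v : G) (p : (powerGraph G)ᶜ.Walk u v), p.IsPath ∧ p.length = 2 := by
  suffices ∃ a b c : G, (powerGraph G)ᶜ.Adj a b ∧ (powerGraph G)ᶜ.Adj b c ∧ a ≠ c by
    obtain ⟨a, b, c, hab, hbc, hac⟩ := this
    exact ⟨a, c, .cons hab (.cons hbc .nil), by simp [hab.ne, hbc.ne, hac], rfl⟩
  by_cases hx : orderOf x = 2
  · by_cases hy : orderOf y = 2
    · refine ⟨x, y, x * y, h, compl_powerGraph_adj_mul_left hx hy h.ne, ?_⟩
      exact (compl_powerGraph_adj_mul_right hx hy h.ne).ne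
    · exact ⟨y, x, y⁻¹, h.symm, compl_powerGraph_adj_inv_right.2 h,
        ne_inv_of_orderOf_ne_two (ne_one_of_compl_powerGraph_adj h.symm) hy⟩
  · exact ⟨x, y, x⁻¹, h, compl_powerGraph_adj_inv_right.2 h.symm,
      ne_inv_of_orderOf_ne_two (ne_one_of_compl_powerGraph_adj h) hx⟩

theorem orderOf_eq_two_or_of_pathLengthLE (hG : PathLengthLE (powerGraph G)ᶜ 2)
    (h : (powerGraph G)ᶜ.Adj x y) : orderOf x = 2 ∨ orderOf y = 2 := by
  by_contra! h2
  have hx : x ≠ x⁻¹ := ne_inv_of_orderOf_ne_two (ne_one_of_compl_powerGraph_adj h) h2.1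
  have hy : y ≠ y⁻¹ := ne_inv_of_orderOf_ne_two (ne_one_of_compl_powerGraph_adj h.symm) h2.2
  have hxy : (powerGraph G)ᶜ.Adj x y⁻¹ := compl_powerGraph_adj_inv_right.2 h
  have hyx : (powerGraph G)ᶜ.Adj y x⁻¹ := compl_powerGraph_adj_inv_right.2 h.symm
  exact hG.not_adj_of_adj_of_adj h hyx hx hxy.ne hy (compl_powerGraph_adj_inv_right.2 hyx.symm)

theorem isKleinFour_of_pathLengthLE (hG : PathLengthLE (powerGraph G)ᶜ 2) (hx : orderOf x = 2)
    (hy : orderOf y = 2) (hne : x ≠ y) : IsKleinFour G := by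
  refine isKleinFour_of_forall_eq hx hy hne fun g => ?_
  by_contra! hg
  have hxy := compl_powerGraph_adj_mul_right hx hy hne
  have hyx := compl_powerGraph_adj_mul_left hx hy hne
  have hadj : (powerGraph G)ᶜ.Adj x y := by
    rw [compl_powerGraph_adj_iff_of_orderOf_eq_two hx, mem_zpowers_iff_of_orderOf_eq_two hy]
    exact ⟨by simp [hne, ne_one_of_compl_powerGraph_adj hxy], ne_one_of_compl_powerGraph_adj hyx⟩
  have hyg : ¬ (powerGraph G)ᶜ.Adj y g :=
    hG.not_adj_of_adj_of_adj hxy.symm hadj hyx.ne.symm hg.2.2.2.symm hg.2.1.symm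
  have hxg : ¬ (powerGraph G)ᶜ.Adj x g :=
    hG.not_adj_of_adj_of_adj hyx.symm hadj.symm hxy.ne.symm hg.2.2.2.symm hg.2.2.1.symm
  rw [compl_powerGraph_adj_iff_of_orderOf_eq_two ‹_›, and_iff_left hg.1, not_not] at hxg hyg
  exact hne (eq_of_mem_zpowers_of_orderOf_eq_two hxg hyg hx hy)

theorem odd_orderOf_of_unique_involution (huniq : ∀ w : G, orderOf w = 2 → w = z)
    (h : (powerGraph G)ᶜ.Adj z y) : Odd (orderOf y) := by
  rw [← Nat.not_even_iff_odd, even_iff_two_dvd]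
  intro hdvd
  have hpow : y ^ (orderOf y / 2) = z :=
    huniq _ (orderOf_pow_orderOf_div (orderOf_pos y).ne' hdvd)
  exact (compl_powerGraph_adj.1 h).1 (hpow ▸ Subgroup.npow_mem_zpowers y _)

theorem mem_zpowers_of_odd_of_star (hz : orderOf z = 2)
    (hstar : ∀ u v : G, (powerGraph G)ᶜ.Adj u v → u = z ∨ v = z) {h w : G} (hne : h ≠ z)
    (hh : 2 ∣ orderOf h) (hw : Odd (orderOf w)) : w ∈ zpowers h := by
  rw [← Nat.not_even_iff_odd, even_iff_two_dvd] at hw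
  by_contra hwh
  have hhw : h ∉ zpowers w := fun hmem => hw (hh.trans (orderOf_dvd_of_mem_zpowers hmem))
  rcases hstar w h (compl_powerGraph_adj.2 ⟨hwh, hhw⟩) with rfl | rfl
  · exact hw (dvd_of_eq hz.symm)
  · exact hne rfl

theorem odd_orderOf_or_odd_orderOf_mul_of_star (hz : orderOf z = 2) (hcomm : ∀ g, Commute z g)
    (hstar : ∀ u v : G, (powerGraph G)ᶜ.Adj u v → u = z ∨ v = z) (hy1 : y ≠ 1)
    (hy : Odd (orderOf y)) (w : G) : Odd (orderOf w) ∨ Odd (orderOf (z * w)) := by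
  obtain ⟨a, m, hm, hw⟩ := Nat.exists_eq_two_pow_mul_odd (orderOf_pos w).ne'
  have hcop : (orderOf (w ^ m)).Coprime (orderOf y) := by
    refine Nat.Coprime.coprime_dvd_left ?_ (hy.coprime_two_left.pow_left a)
    rw [orderOf_dvd_iff_pow_eq_one, ← pow_mul, mul_comm, ← hw, pow_orderOf_eq_one]
  have hwm : w ^ m = 1 ∨ w ^ m = z := by
    refine or_iff_not_imp_left.2 fun h1 => ?_
    refine (hstar _ _ (compl_powerGraph_adj_of_coprime h1 hy1 hcop)).resolve_right ?_
    rintro rfl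
    rw [hz] at hy
    exact absurd hy (by decide)
  rcases hwm with h1 | h2
  · exact Or.inl (hm.of_dvd_nat (orderOf_dvd_of_pow_eq_one h1))
  · refine Or.inr (hm.of_dvd_nat (orderOf_dvd_of_pow_eq_one ?_))
    rw [(hcomm w).mul_pow, h2, ← pow_succ, ← orderOf_dvd_iff_pow_eq_one, hz]
    exact hm.add_one.two_dvd

theorem nonempty_mulEquiv_zmod_of_star (hz : orderOf z = 2)
    (huniq : ∀ w : G, orderOf w = 2 → w = z) (h : (powerGraph G)ᶜ.Adj z x)
    (hstar : ∀ u v : G, (powerGraph G)ᶜ.Adj u v → u = z ∨ v = z) :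
    ∃ q : ℕ, q.Prime ∧ Odd q ∧ Nonempty (G ≃* Multiplicative (ZMod (2 * q))) := by
  obtain ⟨q, hq, hqx⟩ := Nat.exists_prime_and_dvd
    (mt orderOf_eq_one_iff.1 (ne_one_of_compl_powerGraph_adj h.symm))
  have hodd : Odd q := (odd_orderOf_of_unique_involution huniq h).of_dvd_nat hqx
  obtain ⟨y, hy⟩ : ∃ y : G, orderOf y = q :=
    ⟨_, orderOf_pow_orderOf_div (orderOf_pos x).ne' hqx⟩
  have hy1 : y ≠ 1 := fun hy1 => hq.ne_one (by rw [← hy, hy1, orderOf_one])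
  have hcomm := commute_of_unique_involution hz huniq
  have hzy : orderOf (z * y) = 2 * q := by
    rw [(hcomm y).orderOf_mul_eq_mul_orderOf_of_coprime, hz, hy]
    rw [hz, hy]
    exact hodd.coprime_two_left
  have hmem_odd : ∀ w : G, Odd (orderOf w) → w ∈ zpowers (z * y) := fun w =>
    mem_zpowers_of_odd_of_star hz hstar (by simpa using hy1) ⟨q, hzy⟩
  have hmem_z : z ∈ zpowers (z * y) :=
    (Subgroup.mul_mem_cancel_right _ (hmem_odd y (hy.symm ▸ hodd))).1 (mem_zpowers _)
  have hmem : ∀ w, w ∈ zpowers (z * y) := fun w =>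
    (odd_orderOf_or_odd_orderOf_mul_of_star hz hcomm hstar hy1 (hy.symm ▸ hodd) w).elim
      (hmem_odd w) fun hw => (Subgroup.mul_mem_cancel_left _ hmem_z).1 (hmem_odd _ hw)
  have : IsCyclic G := ⟨_, hmem⟩
  have hcard : Nat.card G = 2 * q := by rw [← hzy, orderOf_eq_card_of_forall_mem_zpowers hmem]
  exact ⟨q, hq, hodd, ⟨mulEquivOfCyclicCardEq <| by
    rw [hcard, Nat.card_congr Multiplicative.toAdd, Nat.card_zmod]⟩⟩

theorem nonempty_mulEquiv_of_pathLengthLE (hG : PathLengthLE (powerGraph G)ᶜ 2)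
    (h : (powerGraph G)ᶜ.Adj x y) :
    Nonempty (G ≃* Multiplicative (ZMod 2 × ZMod 2)) ∨
      ∃ q : ℕ, q.Prime ∧ Odd q ∧ Nonempty (G ≃* Multiplicative (ZMod (2 * q))) := by
  wlog hx : orderOf x = 2 generalizing x y
  · exact this h.symm ((orderOf_eq_two_or_of_pathLengthLE hG h).resolve_left hx)
  by_cases huniq : ∀ w : G, orderOf w = 2 → w = x
  · exact Or.inr <| nonempty_mulEquiv_zmod_of_star hx huniq h fun u v huv =>
      (orderOf_eq_two_or_of_pathLengthLE hG huv).imp (huniq u) (huniq v)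
  · push Not at huniq
    obtain ⟨w, hw, hne⟩ := huniq
    have := isKleinFour_of_pathLengthLE hG hw hx hne
    exact Or.inl IsKleinFour.nonempty_mulEquiv

theorem edgesMeet_compl_powerGraph_of_isCyclic [IsCyclic G] {q : ℕ} (hq : q.Prime)
    (hG : Nat.card G = 2 * q) : EdgesMeet (powerGraph G)ᶜ := by
  have hinv : ∀ {u v : G}, (powerGraph G)ᶜ.Adj u v → orderOf u = 2 ∨ orderOf v = 2 := by
    intro u v huv
    rw [compl_powerGraph_adj] at huv
    have hdvd : ∀ w : G, orderOf w ∣ 2 * q := fun w => hG ▸ orderOf_dvd_natCard w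
    rcases dvd_or_dvd_of_dvd_prime_mul Nat.prime_two hq (hdvd u) (hdvd v) with h | h | h
    · exact absurd (mem_zpowers_of_orderOf_dvd h) huv.1
    · exact absurd (mem_zpowers_of_orderOf_dvd h) huv.2
    · exact h
  intro a b c d hab hcd
  rcases hinv hab with ha | hb <;> rcases hinv hcd with hc | hd
  · exact Or.inl (eq_of_orderOf_eq_two ha hc)
  · exact Or.inr (Or.inl (eq_of_orderOf_eq_two ha hd))
  · exact Or.inr (Or.inr (Or.inl (eq_of_orderOf_eq_two hb hc)))
  · exact Or.inr (Or.inr (Or.inr (eq_of_orderOf_eq_two hb hd)))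

theorem edgesMeet_compl_powerGraph (h : Nonempty (G ≃* Multiplicative (ZMod 2 × ZMod 2)) ∨
    ∃ q : ℕ, q.Prime ∧ Odd q ∧ Nonempty (G ≃* Multiplicative (ZMod (2 * q)))) :
    EdgesMeet (powerGraph G)ᶜ := by
  rcases h with ⟨⟨e⟩⟩ | ⟨q, hq, -, ⟨e⟩⟩
  · exact edgesMeet_compl_of_card_le_four isUniversal_one (by simp [Nat.card_congr e.toEquiv])
  · have := isCyclic_of_surjective e.symm e.symm.surjective
    exact edgesMeet_compl_powerGraph_of_isCyclic hq (by
      rw [Nat.card_congr e.toEquiv, Nat.card_congr Multiplicative.toAdd, Nat.card_zmod])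

end PowerGraph

end LambdaNumber

theorem theorem4p1 (G : Type*) [Group G] [Finite G]
    (hG : ¬ (IsCyclic G ∧ ∃ p k : ℕ, p.Prime ∧ Nat.card G = p ^ k)) :
    (LambdaNumber.lambdaNumber (LambdaNumber.powerGraph G) : ℤ) ≤ 2 * (Nat.card G : ℤ) - 4 ∧
    ((LambdaNumber.lambdaNumber (LambdaNumber.powerGraph G) : ℤ) = 2 * (Nat.card G : ℤ) - 4 ↔
      (Nonempty (G ≃* Multiplicative (ZMod 2 × ZMod 2)) ∨
        ∃ q : ℕ, q.Prime ∧ Odd q ∧ Nonempty (G ≃* Multiplicative (ZMod (2 * q))))) := by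
  obtain ⟨x, y, hxy⟩ := LambdaNumber.exists_compl_powerGraph_adj hG
  obtain ⟨_, _, p, hp, hlen⟩ := LambdaNumber.exists_isPath_length_eq_two hxy
  have hle := LambdaNumber.lambdaNumber_add_length_add_two_le hp
  refine ⟨by omega, fun heq => ?_, fun h => ?_⟩
  · refine LambdaNumber.nonempty_mulEquiv_of_pathLengthLE (fun u v p hp => ?_) hxy
    have := LambdaNumber.lambdaNumber_add_length_add_two_le hp
    omega
  · have := LambdaNumber.two_mul_card_le_lambdaNumber_add_four
      (LambdaNumber.ediam_le_two_of_isUniversal LambdaNumber.isUniversal_one)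
      (LambdaNumber.edgesMeet_compl_powerGraph h)
    omega
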